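/- Let $G$ be a finitely generated group and let $H\le G$ be an infinite stable subgroup. Let $\partial_M G$ be the Morse boundary of $G$, with its natural action of $G$, and let $\Lambda_H\subset\partial_M G$ be the limit set of $H$. Then $H$ is contained in the stabilizer $\mathrm{Stab}_G(\Lambda_H)=\{g\in G : g\Lambda_H=\Lambda_H\}$ with finite index. Moreover, $H$ has finite index in its commensurator $\mathrm{Comm}_G(H)=\{g\in G : H\cap gHg^{-1}\text{ has finite index in both } H \text{ and } gHg^{-1}\}$. The notions used are as follows. Equip $G$ with the word metric $d$ of a finite generating set, i.e. the metric of the corresponding Cayley graph. All geodesics and quasigeodesics below are discrete paths in the set of vertices, indexed by intervals of integers. A quasigeodesic $\gamma$ is $f$-stable, for a function $f\colon\mathbb R_{\ge1}\times\mathbb R_{\ge0}\to\mathbb R_{\ge0}$, if for all $K\ge 1$, $\epsilon\ge 0$ every $(K,\epsilon)$-quasigeodesic with endpoints on $\gamma$ lies in the $f(K,\epsilon)$-neighbourhood of $\gamma$. The subgroup $H$ is stable in $G$ if it is finitely generated, the inclusion $H\to G$ is a quasi-isometric embedding for word metrics of finite generating sets of $H$ and $G$, and there is a single $f$ such that the inclusion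 sends every geodesic of $H$ to an $f$-stable quasigeodesic of $G$. This does not depend on the generating sets. A Morse ray is a geodesic ray in $G$ that is $f$-stable for some $f$. The Morse boundary $\partial_M G$ is the set of Morse rays modulo the relation $\alpha\sim\beta$ if $\sup_t d(\alpha(t),\beta(t))<\infty$, and $G$ acts on it by left translation. The limit set $\Lambda_H$ is the set of all classes $[\alpha]\in\partial_M G$ for which there are a sequence $(x_n)$ in $H$ and a function $f$ such that every $x_n$ is joined to $1$ by an $f$-stable geodesic and the Gromov products $(x_i\mid\alpha(j))_1$ tend to infinity as $i,j\to\infty$. -/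

import Mathlib

open Filter
open scoped Pointwise

/-- A finite generating set of a group. -/
structure FinGenSet (G : Type*) [Group G] where
  carrier : Set G
  finite : carrier.Finite
  closure_eq : Subgroup.closure carrier = ⊤

namespace FinGenSet

variable {G : Type*} [Group G] (S : FinGenSet G)

/-- `g` is a product of `n` letters, each a generator or the inverse of one. -/
def IsWordOfLength (g : G) (n : ℕ) : Prop :=
  ∃ l : List G, (∀ x ∈ l, x ∈ S.carrier ∨ x⁻¹ ∈ S.carrier) ∧ l.prod = g ∧ l.length = n

/-- The word length of `g`. -/
noncomputable def wordNorm (g : G) : ℕ := sInf {n | S.IsWordOfLength g n}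

/-- The word metric: the path metric of the Cayley graph of `G` with respect to `S`,
restricted to the vertex set `G` (edges join `g` and `g * s`). -/
noncomputable def wordDist (g h : G) : ℕ := S.wordNorm (g⁻¹ * h)

theorem exists_word (g : G) : ∃ n, S.IsWordOfLength g n := by
  have hg : g ∈ Subgroup.closure S.carrier := by rw [S.closure_eq]; trivial
  rw [← Subgroup.mem_toSubmonoid, Subgroup.closure_toSubmonoid] at hg
  obtain ⟨l, hl, hp⟩ := Submonoid.exists_list_of_mem_closure hg
  exact ⟨l.length, l, fun x hx => by simpa using hl x hx, hp, rfl⟩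

theorem isWordOfLength_wordNorm (g : G) : S.IsWordOfLength g (S.wordNorm g) :=
  Nat.sInf_mem (S.exists_word g)

theorem wordNorm_mul_le (g h : G) : S.wordNorm (g * h) ≤ S.wordNorm g + S.wordNorm h := by
  obtain ⟨l, hl, hp, hn⟩ := S.isWordOfLength_wordNorm g
  obtain ⟨m, hm, hq, hk⟩ := S.isWordOfLength_wordNorm h
  refine Nat.sInf_le ⟨l ++ m, ?_, by simp [hp, hq], by simp [hn, hk]⟩
  intro x hx
  rcases List.mem_append.1 hx with h | h
  exacts [hl x h, hm x h]

theorem wordNorm_inv_le (g : G) : S.wordNorm g⁻¹ ≤ S.wordNorm g := by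
  obtain ⟨l, hl, hp, hn⟩ := S.isWordOfLength_wordNorm g
  refine Nat.sInf_le ⟨(l.map (·⁻¹)).reverse, ?_, by rw [← hp, List.prod_inv_reverse], by simp [hn]⟩
  intro x hx
  simp only [List.mem_reverse, List.mem_map] at hx
  obtain ⟨y, hy, rfl⟩ := hx
  simpa using (hl y hy).symm

theorem wordDist_self (g : G) : S.wordDist g g = 0 :=
  Nat.le_zero.1 (Nat.sInf_le ⟨[], by simp, by simp, rfl⟩)

theorem wordDist_comm_le (g h : G) : S.wordDist g h ≤ S.wordDist h g := by
  simpa [wordDist] using S.wordNorm_inv_le (h⁻¹ * g)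

theorem wordDist_triangle (g h k : G) : S.wordDist g k ≤ S.wordDist g h + S.wordDist h k := by
  simpa [wordDist, mul_assoc] using S.wordNorm_mul_le (g⁻¹ * h) (h⁻¹ * k)

theorem wordDist_mul_left (a g h : G) : S.wordDist (a * g) (a * h) = S.wordDist g h := by
  simp [wordDist, mul_assoc]

/-- The Gromov product `(x | y)_o` in the word metric. -/
noncomputable def gromovProduct (o x y : G) : ℝ :=
  ((S.wordDist o x : ℝ) + S.wordDist o y - S.wordDist x y) / 2

/-- `γ`, restricted to the interval `I` of `ℤ`, is a geodesic of the Cayley graph, recorded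
by the vertices it passes through. Values outside `I` are irrelevant. -/
def IsGeodesicOn (γ : ℤ → G) (I : Set ℤ) : Prop :=
  I.OrdConnected ∧ ∀ i ∈ I, ∀ j ∈ I, (S.wordDist (γ i) (γ j) : ℤ) = |i - j|

/-- `η`, restricted to the interval `I` of `ℤ`, is a (discrete) `(K, ε)`-quasigeodesic. -/
def IsQuasiGeodesicOn (K ε : ℝ) (η : ℤ → G) (I : Set ℤ) : Prop :=
  I.OrdConnected ∧ ∀ i ∈ I, ∀ j ∈ I,
    |(i : ℝ) - j| / K - ε ≤ S.wordDist (η i) (η j) ∧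
      (S.wordDist (η i) (η j) : ℝ) ≤ K * |(i : ℝ) - j| + ε

/-- The path `γ` on `I` is an `f`-stable quasigeodesic: it is a quasigeodesic, and for all
`K ≥ 1` and `ε ≥ 0`, every `(K, ε)`-quasigeodesic with endpoints on `γ` lies in the
`f K ε`-neighbourhood of `γ`. -/
def IsStableOn (f : ℝ → ℝ → ℝ) (γ : ℤ → G) (I : Set ℤ) : Prop :=
  (∃ K ε : ℝ, 1 ≤ K ∧ 0 ≤ ε ∧ S.IsQuasiGeodesicOn K ε γ I) ∧
  ∀ K ε : ℝ, 1 ≤ K → 0 ≤ ε → ∀ (η : ℤ → G) (a b : ℤ), a ≤ b →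
    S.IsQuasiGeodesicOn K ε η (Set.Icc a b) → η a ∈ γ '' I → η b ∈ γ '' I →
      ∀ i ∈ Set.Icc a b, ∃ j ∈ I, (S.wordDist (η i) (γ j) : ℝ) ≤ f K ε

variable {S} in
theorem IsGeodesicOn.mul_left {γ : ℤ → G} {I : Set ℤ} (h : S.IsGeodesicOn γ I) (a : G) :
    S.IsGeodesicOn (fun i => a * γ i) I :=
  ⟨h.1, fun i hi j hj => by rw [wordDist_mul_left]; exact h.2 i hi j hj⟩

variable {S} in
theorem IsQuasiGeodesicOn.mul_left {K ε : ℝ} {γ : ℤ → G} {I : Set ℤ}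
    (h : S.IsQuasiGeodesicOn K ε γ I) (a : G) :
    S.IsQuasiGeodesicOn K ε (fun i => a * γ i) I :=
  ⟨h.1, fun i hi j hj => by rw [wordDist_mul_left]; exact h.2 i hi j hj⟩

variable {S} in
theorem IsStableOn.mul_left {f : ℝ → ℝ → ℝ} {γ : ℤ → G} {I : Set ℤ}
    (h : S.IsStableOn f γ I) (a : G) : S.IsStableOn f (fun i => a * γ i) I := by
  obtain ⟨⟨K, ε, hK, hε, hq⟩, h⟩ := h
  refine ⟨⟨K, ε, hK, hε, hq.mul_left a⟩, fun K ε hK hε η s t hst hη hs ht i hi => ?_⟩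
  obtain ⟨p, hp, hps⟩ := hs
  obtain ⟨q, hq, hqt⟩ := ht
  obtain ⟨j, hj, hd⟩ := h K ε hK hε (fun i => a⁻¹ * η i) s t hst (hη.mul_left a⁻¹)
    ⟨p, hp, by simp [← hps]⟩ ⟨q, hq, by simp [← hqt]⟩ i hi
  refine ⟨j, hj, ?_⟩
  rwa [← S.wordDist_mul_left a, mul_inv_cancel_left] at hd

/-- `x` is joined to the base point `1` by an `f`-stable geodesic segment. -/
def IsStablyJoined (f : ℝ → ℝ → ℝ) (x : G) : Prop :=
  ∃ (γ : ℤ → G) (n : ℤ), 0 ≤ n ∧ S.IsGeodesicOn γ (Set.Icc 0 n) ∧ γ 0 = 1 ∧ γ n = x ∧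
    S.IsStableOn f γ (Set.Icc 0 n)

end FinGenSet

/-- A Morse geodesic ray in the Cayley graph of `G` with respect to `S`: a geodesic ray,
starting at any vertex, which is `f`-stable for some `f`. -/
structure MorseRay {G : Type*} [Group G] (S : FinGenSet G) where
  toFun : ℤ → G
  isGeodesic : S.IsGeodesicOn toFun (Set.Ici 0)
  isStable : ∃ f : ℝ → ℝ → ℝ, S.IsStableOn f toFun (Set.Ici 0)

/-- Two Morse rays are asymptotic if they stay at bounded distance. -/
def MorseRay.setoid {G : Type*} [Group G] (S : FinGenSet G) : Setoid (MorseRay S) where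
  r α β := ∃ C : ℕ, ∀ t : ℤ, 0 ≤ t → S.wordDist (α.toFun t) (β.toFun t) ≤ C
  iseqv :=
    { refl := fun _ => ⟨0, fun _ _ => (S.wordDist_self _).le⟩
      symm := fun ⟨C, hC⟩ => ⟨C, fun t ht => (S.wordDist_comm_le _ _).trans (hC t ht)⟩
      trans := fun ⟨C, hC⟩ ⟨D, hD⟩ => ⟨C + D, fun t ht =>
        (S.wordDist_triangle _ _ _).trans (add_le_add (hC t ht) (hD t ht))⟩ }

/-- The Morse boundary of `G` (as a set): asymptote classes of Morse geodesic rays in the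
Cayley graph of `G` with respect to `S`. -/
def MorseBoundary {G : Type*} [Group G] (S : FinGenSet G) : Type _ :=
  Quotient (MorseRay.setoid S)

namespace MorseBoundary

variable {G : Type*} [Group G] {S : FinGenSet G}

/-- The boundary point of a Morse ray. -/
def mk (α : MorseRay S) : MorseBoundary S := Quotient.mk (MorseRay.setoid S) α

/-- The action of `G` on its Morse boundary induced by left translation. -/
instance : MulAction G (MorseBoundary S) where
  smul g := Quotient.map (sa := MorseRay.setoid S) (sb := MorseRay.setoid S)
    (fun α => ⟨fun t => g * α.toFun t, α.isGeodesic.mul_left g,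
      α.isStable.imp fun _ h => h.mul_left g⟩)
    (fun _ _ ⟨C, hC⟩ => ⟨C, fun t ht => by
      simpa only [S.wordDist_mul_left] using hC t ht⟩)
  one_smul x := by
    induction x using Quotient.inductionOn with | _ α
    refine congrArg (Quotient.mk (MorseRay.setoid S)) ?_
    cases α
    simp
  mul_smul g h x := by
    induction x using Quotient.inductionOn with | _ α
    refine congrArg (Quotient.mk (MorseRay.setoid S)) ?_
    simp [mul_assoc]

/-- The sequence `x` of vertices represents the boundary point `ξ`: its members are joined to
the base point `1` by `f`-stable geodesics with one common `f`, and it converges to a ray in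
the class `ξ`, in the sense that the Gromov products of the two tend to infinity. -/
def IsRepresentedBy (ξ : MorseBoundary S) (x : ℕ → G) : Prop :=
  (∃ f : ℝ → ℝ → ℝ, ∀ n, S.IsStablyJoined f (x n)) ∧
  ∃ α : MorseRay S, mk α = ξ ∧
    Tendsto (fun p : ℕ × ℕ => S.gromovProduct 1 (x p.1) (α.toFun p.2)) atTop atTop

end MorseBoundary

/-- The limit set of a subgroup `H` in the Morse boundary: the points represented by sequences
in the orbit `H · 1 = H`. -/
def limitSet {G : Type*} [Group G] (S : FinGenSet G) (H : Subgroup G) :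
    Set (MorseBoundary S) :=
  {ξ | ∃ x : ℕ → G, (∀ n, x n ∈ H) ∧ ξ.IsRepresentedBy x}

/-- `Φ` is a quasi-isometric embedding for the word metrics of `T` and `S`. -/
def IsQIEmbedding {H G : Type*} [Group H] [Group G] (T : FinGenSet H) (S : FinGenSet G)
    (Φ : H → G) : Prop :=
  ∃ K ε : ℝ, 1 ≤ K ∧ 0 ≤ ε ∧ ∀ x y : H,
    (T.wordDist x y : ℝ) / K - ε ≤ S.wordDist (Φ x) (Φ y) ∧
      (S.wordDist (Φ x) (Φ y) : ℝ) ≤ K * T.wordDist x y + ε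

/-- `Φ` is a stable embedding: a quasi-isometric embedding such that, for one common
stability function `f`, the image of every geodesic is an `f`-stable quasigeodesic. -/
def IsStableEmbedding {H G : Type*} [Group H] [Group G] (T : FinGenSet H) (S : FinGenSet G)
    (Φ : H → G) : Prop :=
  IsQIEmbedding T S Φ ∧
  ∃ f : ℝ → ℝ → ℝ, ∀ (γ : ℤ → H) (I : Set ℤ), T.IsGeodesicOn γ I →
    S.IsStableOn f (fun i => Φ (γ i)) I

/-- `H` is a stable subgroup of `G`: both groups are finitely generated and the inclusion is a
stable embedding for some (equivalently, any) choice of finite generating sets. -/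
def IsStableSubgroup {G : Type*} [Group G] (H : Subgroup G) : Prop :=
  ∃ (S : FinGenSet G) (T : FinGenSet H), IsStableEmbedding T S (H.subtype : H → G)

/-!
Let `H` be a stable subgroup of `G`. Points of `H` are joined by uniformly stable quasigeodesics
inside `H`, so `H` is a *Morse set*: quasigeodesics of `G` with endpoints in `H` stay near `H`
(`IsStableEmbedding.isMorseSet`). If `H` is infinite, some bi-infinite geodesic `γ` of `G` stays in
a neighbourhood of `H` (`IsMorseSet.exists_geodesic_line`), and both of its ends are points of the
limit set `Λ` (`IsStableEmbedding.exists_morseRay`), because geodesics of `G` with endpoints near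
`H` are uniformly stable (`IsStableEmbedding.exists_isStableOn`).

If `g` stabilizes `Λ`, then both ends of `g • γ` are limit points of `H`, so `g • γ` returns
infinitely often in both directions to some neighbourhood of `H`
(`IsMorseSet.exists_isRecurrent_of_mem_limitSet`). The radius of this neighbourhood depends on `g`,
but it can then be replaced by a uniform one (`IsMorseSet.isRecurrent`). Hence `g • γ 0` lies on a
geodesic whose endpoints are uniformly close to `H`, and so `g` itself is uniformly close to `H`
(`IsMorseSet.isNear_of_isRecurrent`). As balls are finite, `H` has finite index in the stabilizer.
If `g` commensurates `H` instead, then `g H`, and with it all of `g • γ`, lies in a neighbourhood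
of `H`, and the same argument applies.

The quasigeodesics used are obtained by attaching to a path a geodesic that joins an outside point
to a nearest point of the path (`IsChordArc.exists_attach`).
-/

namespace FinGenSet

variable {G : Type*} [Group G] (S : FinGenSet G)

/-! ### Word metrics -/

theorem wordDist_comm (g h : G) : S.wordDist g h = S.wordDist h g :=
  le_antisymm (S.wordDist_comm_le g h) (S.wordDist_comm_le h g)

theorem wordNorm_list_prod_le {l : List G} {L : ℕ} (hl : ∀ x ∈ l, S.wordNorm x ≤ L) :
    S.wordNorm l.prod ≤ L * l.length := by
  induction l with
  | nil => simpa [wordDist] using (S.wordDist_self 1).le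
  | cons x l ih =>
    have h1 := ih fun y hy => hl y (List.mem_cons_of_mem _ hy)
    have h2 := hl x List.mem_cons_self
    have h3 := S.wordNorm_mul_le x l.prod
    simp only [List.prod_cons, List.length_cons]
    linarith [mul_add_one L l.length]

theorem wordNorm_le_one {x : G} (hx : x ∈ S.carrier ∨ x⁻¹ ∈ S.carrier) : S.wordNorm x ≤ 1 :=
  Nat.sInf_le ⟨[x], by simpa using hx, by simp, rfl⟩

/-- Two word metrics on a group are Lipschitz equivalent. -/
theorem exists_wordDist_le_mul (S' : FinGenSet G) :
    ∃ L : ℕ, 1 ≤ L ∧ ∀ g h : G, S.wordDist g h ≤ L * S'.wordDist g h := by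
  obtain ⟨L, hL⟩ := (S'.finite.image S.wordNorm).bddAbove
  refine ⟨L + 1, by omega, fun g h => ?_⟩
  obtain ⟨l, hl, hp, hn⟩ := S'.isWordOfLength_wordNorm (g⁻¹ * h)
  rw [wordDist, wordDist, ← hn, ← hp]
  refine S.wordNorm_list_prod_le fun x hx => ?_
  rcases hl x hx with h | h
  · exact (hL ⟨x, h, rfl⟩).trans (by omega)
  · have := hL ⟨_, h, rfl⟩
    have h2 := S.wordNorm_inv_le x⁻¹
    rw [inv_inv] at h2
    omega

theorem finite_ball (n : ℕ) : {g : G | S.wordNorm g ≤ n}.Finite := by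
  have hA : (S.carrier ∪ S.carrier⁻¹).Finite := S.finite.union S.finite.inv
  have key : ∀ n : ℕ, {g : G | S.IsWordOfLength g n}.Finite := by
    intro n
    induction n with
    | zero =>
      refine (Set.finite_singleton (1 : G)).subset ?_
      rintro g ⟨l, -, hp, hn⟩
      rw [List.length_eq_zero_iff] at hn
      simp [← hp, hn]
    | succ n ih =>
      refine (hA.mul ih).subset ?_
      rintro g ⟨l, hl, hp, hn⟩
      obtain ⟨x, l, rfl⟩ := List.exists_cons_of_length_eq_add_one hn
      exact ⟨x, by simpa using hl x List.mem_cons_self, l.prod,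
        ⟨l, fun y hy => hl y (List.mem_cons_of_mem _ hy), rfl, by simpa using hn⟩, by simpa using hp⟩
  refine ((Set.finite_Iic n).biUnion fun k _ => key k).subset fun g hg => ?_
  exact Set.mem_biUnion (Set.mem_Iic.2 hg) (S.isWordOfLength_wordNorm g)

theorem finite_setOf_wordDist_le (x : G) (n : ℕ) : {g : G | S.wordDist x g ≤ n}.Finite :=
  (S.finite_ball n).preimage (mul_right_injective x⁻¹).injOn

theorem gromovProduct_le (o o' x x' y y' : G) :
    S.gromovProduct o x y ≤ S.gromovProduct o' x' y' + S.wordDist o o' + S.wordDist x x' +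
      S.wordDist y y' := by
  have h1 : (S.wordDist o x : ℝ) ≤ S.wordDist o o' + S.wordDist o' x' + S.wordDist x x' := by
    have a := S.wordDist_triangle o o' x
    have b := S.wordDist_triangle o' x' x
    rw [S.wordDist_comm x' x] at b
    exact_mod_cast (by omega : S.wordDist o x ≤
      S.wordDist o o' + S.wordDist o' x' + S.wordDist x x')
  have h2 : (S.wordDist o y : ℝ) ≤ S.wordDist o o' + S.wordDist o' y' + S.wordDist y y' := by
    have a := S.wordDist_triangle o o' y
    have b := S.wordDist_triangle o' y' y
    rw [S.wordDist_comm y' y] at b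
    exact_mod_cast (by omega : S.wordDist o y ≤
      S.wordDist o o' + S.wordDist o' y' + S.wordDist y y')
  have h3 : (S.wordDist x' y' : ℝ) ≤ S.wordDist x x' + S.wordDist x y + S.wordDist y y' := by
    have a := S.wordDist_triangle x' x y'
    have b := S.wordDist_triangle x y y'
    rw [S.wordDist_comm x' x] at a
    exact_mod_cast (by omega : S.wordDist x' y' ≤
      S.wordDist x x' + S.wordDist x y + S.wordDist y y')
  unfold gromovProduct
  linarith

theorem gromovProduct_mul_left (a o x y : G) :
    S.gromovProduct (a * o) (a * x) (a * y) = S.gromovProduct o x y := by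
  simp only [gromovProduct, wordDist_mul_left]

/-! ### Geodesics and chord-arc paths -/

/-- The path `η` on `[a, b]` is `1`-Lipschitz and satisfies the chord-arc condition with constant
`L`: the length of each subpath is at most `L` times the distance of its endpoints. For `L = 1`
these are the geodesics, and in general they are `(L, 0)`-quasigeodesics. -/
def IsChordArc (L : ℕ) (η : ℤ → G) (a b : ℤ) : Prop :=
  ∀ i j : ℤ, a ≤ i → i ≤ j → j ≤ b →
    (S.wordDist (η i) (η j) : ℤ) ≤ j - i ∧ j - i ≤ L * S.wordDist (η i) (η j)

variable {S}

theorem IsGeodesicOn.isQuasiGeodesicOn {γ : ℤ → G} {I : Set ℤ} (h : S.IsGeodesicOn γ I) :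
    S.IsQuasiGeodesicOn 1 0 γ I := by
  refine ⟨h.1, fun i hi j hj => ?_⟩
  have : (S.wordDist (γ i) (γ j) : ℝ) = |(i : ℝ) - j| := by exact_mod_cast h.2 i hi j hj
  simp [this]

theorem IsGeodesicOn.isChordArc {γ : ℤ → G} {a b : ℤ} (h : S.IsGeodesicOn γ (Set.Icc a b)) :
    S.IsChordArc 1 γ a b := by
  intro i j hi hij hj
  have := h.2 i ⟨hi, hij.trans hj⟩ j ⟨hi.trans hij, hj⟩
  rw [abs_of_nonpos (by omega)] at this
  omega

theorem IsChordArc.isGeodesicOn {γ : ℤ → G} {a b : ℤ} (h : S.IsChordArc 1 γ a b) :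
    S.IsGeodesicOn γ (Set.Icc a b) := by
  refine ⟨Set.ordConnected_Icc, fun i hi j hj => ?_⟩
  rcases le_total i j with hij | hij
  · have := h i j hi.1 hij hj.2
    rw [abs_of_nonpos (by omega)]
    omega
  · have := h j i hj.1 hij hi.2
    rw [abs_of_nonneg (by omega), S.wordDist_comm]
    omega

theorem IsChordArc.isQuasiGeodesicOn {L : ℕ} (hL : 1 ≤ L) {η : ℤ → G} {a b : ℤ}
    (h : S.IsChordArc L η a b) : S.IsQuasiGeodesicOn L 0 η (Set.Icc a b) := by
  have hL' : (1 : ℝ) ≤ L := by exact_mod_cast hL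
  have key : ∀ i j : ℤ, a ≤ i → i ≤ j → j ≤ b →
      |(i : ℝ) - j| / L - 0 ≤ S.wordDist (η i) (η j) ∧
      (S.wordDist (η i) (η j) : ℝ) ≤ L * |(i : ℝ) - j| + 0 := by
    intro i j hi hij hj
    obtain ⟨h1, h2⟩ := h i j hi hij hj
    have hij' : (i : ℝ) ≤ j := by exact_mod_cast hij
    have h1' : (S.wordDist (η i) (η j) : ℝ) ≤ j - i := by exact_mod_cast h1
    have h2' : (j : ℝ) - i ≤ L * S.wordDist (η i) (η j) := by exact_mod_cast h2
    rw [abs_of_nonpos (by linarith), sub_zero, add_zero, div_le_iff₀ (by linarith)]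
    exact ⟨by linarith, by nlinarith⟩
  refine ⟨Set.ordConnected_Icc, fun i hi j hj => ?_⟩
  rcases le_total i j with hij | hij
  · exact key i j hi.1 hij hj.2
  · rw [abs_sub_comm, S.wordDist_comm]
    exact key j i hj.1 hij hi.2

theorem IsChordArc.mono {L : ℕ} {η : ℤ → G} {a b a' b' : ℤ} (h : S.IsChordArc L η a b)
    (ha : a ≤ a') (hb : b' ≤ b) : S.IsChordArc L η a' b' :=
  fun i j hi hij hj => h i j (ha.trans hi) hij (hj.trans hb)

theorem IsChordArc.reverse {L : ℕ} {η : ℤ → G} {a b : ℤ} (h : S.IsChordArc L η a b) :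
    S.IsChordArc L (fun i => η (-i)) (-b) (-a) := by
  intro i j hi hij hj
  have := h (-j) (-i) (by omega) (by omega) (by omega)
  rw [S.wordDist_comm]
  constructor <;> linarith [this.1, this.2]

variable (S)

/-- Any two points are joined by a geodesic, starting at any given time. -/
theorem exists_isChordArc_one (x y : G) (a : ℤ) :
    ∃ γ : ℤ → G, S.IsChordArc 1 γ a (a + S.wordDist x y) ∧ γ a = x ∧
      γ (a + S.wordDist x y) = y := by
  obtain ⟨l, hl, hp, hn⟩ := S.isWordOfLength_wordNorm (x⁻¹ * y)
  have hn' : l.length = S.wordDist x y := hn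
  let γ : ℤ → G := fun i => x * (l.take (i - a).toNat).prod
  have h0 : γ a = x := by simp [γ]
  have h1 : γ (a + S.wordDist x y) = y := by simp [γ, ← hn', hp]
  have hlip : ∀ i j : ℤ, a ≤ i → i ≤ j → (S.wordDist (γ i) (γ j) : ℤ) ≤ j - i := by
    intro i j hi hij
    have e : l.take (j - a).toNat =
        l.take (i - a).toNat ++ (l.drop (i - a).toNat).take (j - i).toNat := by
      rw [← List.take_add]
      congr 1
      omega
    have : S.wordDist (γ i) (γ j) ≤ 1 * ((l.drop (i - a).toNat).take (j - i).toNat).length := by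
      have e2 : (γ i)⁻¹ * γ j = ((l.drop (i - a).toNat).take (j - i).toNat).prod := by
        simp only [γ, e, List.prod_append]
        group
      rw [wordDist, e2]
      exact S.wordNorm_list_prod_le fun x hx =>
        S.wordNorm_le_one (hl x (List.mem_of_mem_drop (List.mem_of_mem_take hx)))
    have h3 : ((l.drop (i - a).toNat).take (j - i).toNat).length ≤ (j - i).toNat :=
      List.length_take_le _ _
    omega
  refine ⟨γ, fun i j hi hij hj => ⟨hlip i j hi hij, ?_⟩, h0, h1⟩
  have t1 := S.wordDist_triangle (γ a) (γ i) (γ (a + S.wordDist x y))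
  have t2 := S.wordDist_triangle (γ i) (γ j) (γ (a + S.wordDist x y))
  have l1 := hlip a i le_rfl hi
  have l2 := hlip j _ (hi.trans hij) hj
  rw [h0, h1] at t1
  rw [h1] at t2
  rw [h0] at l1
  rw [h1] at l2
  push_cast
  omega

variable {S}

/-- A path followed from a point nearest to `p`, preceded by a geodesic from `p`, is again a
chord-arc path: a point at distance `s` from the corner on the geodesic leg has distance at least
`s` from the path. -/
theorem IsChordArc.exists_attach {L : ℕ} (hL : 1 ≤ L) {η : ℤ → G} {m n : ℤ}
    (h : S.IsChordArc L η m n) (p : G)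
    (hp : ∀ j, m ≤ j → j ≤ n → S.wordDist p (η m) ≤ S.wordDist p (η j)) :
    ∃ η' : ℤ → G, S.IsChordArc (2 * L + 1) η' (m - S.wordDist p (η m)) n ∧
      η' (m - S.wordDist p (η m)) = p ∧ ∀ j, m ≤ j → η' j = η j := by
  obtain ⟨γ, hγ, h0, h1⟩ := S.exists_isChordArc_one p (η m) (m - S.wordDist p (η m))
  rw [sub_add_cancel] at hγ h1
  set a : ℤ := m - S.wordDist p (η m) with ha
  refine ⟨fun i => if m ≤ i then η i else γ i, ?_, ?_, fun j hj => by simp [hj]⟩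
  · intro i j hi hij hj
    by_cases hmi : m ≤ i
    · have hmj : m ≤ j := hmi.trans hij
      simp only [hmi, hmj, if_true]
      obtain ⟨h2, h3⟩ := h i j hmi hij hj
      refine ⟨h2, h3.trans ?_⟩
      gcongr
      omega
    by_cases hmj : m ≤ j
    · simp only [hmi, hmj, if_true, if_false]
      have g1 := (hγ a i le_rfl hi (by omega)).1
      have g2 := (hγ i m hi (by omega) le_rfl).1
      obtain ⟨g3, g4⟩ := h m j le_rfl hmj hj
      have g5 := hp j hmj hj
      have t1 := S.wordDist_triangle p (γ i) (η j)
      have t2 := S.wordDist_triangle (γ i) (η m) (η j)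
      have t3 := S.wordDist_triangle (η m) (γ i) (η j)
      rw [S.wordDist_comm (η m) (γ i)] at t3
      rw [h0] at g1
      rw [h1] at g2
      refine ⟨by omega, ?_⟩
      have g6 : (m : ℤ) - i ≤ S.wordDist (γ i) (η j) := by omega
      have g7 : S.wordDist (η m) (η j) ≤ 2 * S.wordDist (γ i) (η j) := by omega
      have g8 : (L : ℤ) * S.wordDist (η m) (η j) ≤ L * (2 * S.wordDist (γ i) (η j)) := by
        gcongr
        exact_mod_cast g7
      push_cast
      linarith
    · simp only [hmi, hmj, if_false]
      obtain ⟨h2, h3⟩ := hγ i j hi hij (by omega)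
      refine ⟨h2, h3.trans ?_⟩
      gcongr
      omega
  · by_cases hma : m ≤ a
    · have : a = m := by omega
      have h2 : γ a = η m := by rw [this, h1]
      exact (if_pos hma).trans ((congrArg η this).trans (h2.symm.trans h0))
    · simp [hma, h0]

end FinGenSet

namespace FinGenSet

variable {G : Type*} [Group G]

/-! ### Morse subsets and stable subgroups -/

/-- The set `A` of vertices is Morse with gauge `F`: every `(K, ε)`-quasigeodesic with endpoints
in `A` stays in the `F K ε`-neighbourhood of `A`. Gauges are natural numbers, which loses nothing
as the word metric takes values in `ℕ`. -/
def IsMorseSet (S : FinGenSet G) (F : ℝ → ℝ → ℕ) (A : Set G) : Prop :=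
  ∀ K ε : ℝ, 1 ≤ K → 0 ≤ ε → ∀ (η : ℤ → G) (a b : ℤ), a ≤ b →
    S.IsQuasiGeodesicOn K ε η (Set.Icc a b) → η a ∈ A → η b ∈ A →
      ∀ i ∈ Set.Icc a b, ∃ x ∈ A, S.wordDist (η i) x ≤ F K ε

/-- The point `g` lies in the `n`-neighbourhood of the subgroup `H`. -/
def IsNear (S : FinGenSet G) (H : Subgroup G) (n : ℕ) (g : G) : Prop :=
  ∃ h ∈ H, S.wordDist g h ≤ n

variable {S : FinGenSet G}

theorem IsNear.trans_le {H : Subgroup G} {m n : ℕ} {x y : G} (h : S.IsNear H m x)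
    (hn : S.wordDist y x + m ≤ n) : S.IsNear H n y := by
  obtain ⟨k, hk, hd⟩ := h
  exact ⟨k, hk, (S.wordDist_triangle y x k).trans (by omega)⟩

theorem isNear_of_mem {H : Subgroup G} {x : G} (h : x ∈ H) : S.IsNear H 0 x :=
  ⟨x, h, (S.wordDist_self x).le⟩

theorem IsNear.mul_left {H : Subgroup G} {n : ℕ} {x k : G} (h : S.IsNear H n x) (hk : k ∈ H) :
    S.IsNear H n (k * x) := by
  obtain ⟨y, hy, hd⟩ := h
  exact ⟨k * y, H.mul_mem hk hy, by rwa [S.wordDist_mul_left]⟩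

theorem IsQuasiGeodesicOn.of_wordDist_le {K ε : ℝ} {D : ℕ} {η η' : ℤ → G} {I : Set ℤ}
    (h : S.IsQuasiGeodesicOn K ε η I) (hD : ∀ i ∈ I, S.wordDist (η i) (η' i) ≤ D) :
    S.IsQuasiGeodesicOn K (ε + 2 * D) η' I := by
  refine ⟨h.1, fun i hi j hj => ?_⟩
  obtain ⟨h1, h2⟩ := h.2 i hi j hj
  have a1 := hD i hi
  have a2 := hD j hj
  have t1 := S.wordDist_triangle (η i) (η' i) (η j)
  have t2 := S.wordDist_triangle (η' i) (η' j) (η j)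
  have t3 := S.wordDist_triangle (η' i) (η i) (η' j)
  have t4 := S.wordDist_triangle (η i) (η j) (η' j)
  rw [S.wordDist_comm (η' j) (η j)] at t2
  rw [S.wordDist_comm (η' i) (η i)] at t3
  have u1 : (S.wordDist (η i) (η j) : ℝ) ≤ S.wordDist (η' i) (η' j) + 2 * D := by
    exact_mod_cast (by omega : S.wordDist (η i) (η j) ≤ S.wordDist (η' i) (η' j) + 2 * D)
  have u2 : (S.wordDist (η' i) (η' j) : ℝ) ≤ S.wordDist (η i) (η j) + 2 * D := by
    exact_mod_cast (by omega : S.wordDist (η' i) (η' j) ≤ S.wordDist (η i) (η j) + 2 * D)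
  constructor <;> linarith

/-- Quasigeodesics with endpoints close to a Morse set stay close to it: moving the two endpoints
onto the set only enlarges the additive constant. -/
theorem IsMorseSet.exists_wordDist_le {F : ℝ → ℝ → ℕ} {A : Set G} (hA : S.IsMorseSet F A)
    {K ε : ℝ} (hK : 1 ≤ K) (hε : 0 ≤ ε) {η : ℤ → G} {a b : ℤ} (hab : a ≤ b)
    (hη : S.IsQuasiGeodesicOn K ε η (Set.Icc a b)) {D : ℕ}
    (ha : ∃ x ∈ A, S.wordDist (η a) x ≤ D) (hb : ∃ x ∈ A, S.wordDist (η b) x ≤ D)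
    {i : ℤ} (hi : i ∈ Set.Icc a b) :
    ∃ x ∈ A, S.wordDist (η i) x ≤ F K (ε + 2 * D) + D := by
  obtain ⟨x, hx, hxd⟩ := ha
  obtain ⟨y, hy, hyd⟩ := hb
  let η' : ℤ → G := fun i => if i = a then x else if i = b then y else η i
  have hd : ∀ i ∈ Set.Icc a b, S.wordDist (η i) (η' i) ≤ D := by
    intro i _
    by_cases h1 : i = a
    · simpa [η', h1] using hxd
    by_cases h2 : i = b
    · subst h2
      simpa [η', h1] using hyd
    · simp [η', h1, h2, S.wordDist_self]
  have hb' : η' b ∈ A := by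
    by_cases h1 : b = a
    · simpa [η', h1] using hx
    · simpa [η', h1] using hy
  obtain ⟨z, hz, hzd⟩ := hA K (ε + 2 * D) hK (by positivity) η' a b hab
    (hη.of_wordDist_le hd) (by simpa [η'] using hx) hb' i hi
  refine ⟨z, hz, (S.wordDist_triangle _ (η' i) _).trans ?_⟩
  have := hd i hi
  omega

theorem IsStableOn.isMorseSet {f : ℝ → ℝ → ℝ} {γ : ℤ → G} {I : Set ℤ} (h : S.IsStableOn f γ I) :
    S.IsMorseSet (fun K ε => ⌊f K ε⌋₊) (γ '' I) := by
  intro K ε hK hε η a b hab hη ha hb i hi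
  obtain ⟨j, hj, hd⟩ := h.2 K ε hK hε η a b hab hη ha hb i hi
  exact ⟨γ j, ⟨j, hj, rfl⟩, Nat.le_floor hd⟩

theorem quasi_bounds_of_bilipschitz {K ε a d d' : ℝ} {L : ℕ} (hL : 1 ≤ L) (hε : 0 ≤ ε)
    (h : a / K - ε ≤ d ∧ d ≤ K * a + ε) (h1 : d ≤ L * d') (h2 : d' ≤ L * d) :
    a / (K * L) - L * ε ≤ d' ∧ d' ≤ K * L * a + L * ε := by
  have hL' : (1 : ℝ) ≤ L := by exact_mod_cast hL
  constructor
  · rw [← div_div]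
    have : a / K / L ≤ (L * d' + ε) / L := by
      gcongr
      linarith
    have e : (L * d' + ε) / L = d' + ε / L := by field_simp
    have e2 : ε / L ≤ L * ε := (div_le_self hε hL').trans (by nlinarith)
    linarith
  · have : L * d ≤ L * (K * a + ε) := by gcongr; exact h.2
    linarith

/-- Stability of an embedding does not depend on the generating set of the target. -/
theorem _root_.IsStableEmbedding.change_target {H : Type*} [Group H] {T : FinGenSet H}
    {Φ : H → G} (h : IsStableEmbedding T S Φ) (S' : FinGenSet G) :
    IsStableEmbedding T S' Φ := by
  obtain ⟨⟨K, ε, hK, hε, hq⟩, f, hf⟩ := h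
  obtain ⟨L₁, hL₁, h₁⟩ := S.exists_wordDist_le_mul S'
  obtain ⟨L₂, hL₂, h₂⟩ := S'.exists_wordDist_le_mul S
  set L : ℕ := max L₁ L₂
  have hL : 1 ≤ L := hL₁.trans (le_max_left _ _)
  have hL' : (1 : ℝ) ≤ L := by exact_mod_cast hL
  have b₁ : ∀ x y, (S.wordDist x y : ℝ) ≤ L * S'.wordDist x y := fun x y => by
    exact_mod_cast (h₁ x y).trans (Nat.mul_le_mul_right _ (le_max_left _ _))
  have b₂ : ∀ x y, (S'.wordDist x y : ℝ) ≤ L * S.wordDist x y := fun x y => by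
    exact_mod_cast (h₂ x y).trans (Nat.mul_le_mul_right _ (le_max_right _ _))
  refine ⟨⟨K * L, L * ε, by nlinarith, by positivity, fun x y =>
    quasi_bounds_of_bilipschitz hL hε (hq x y) (b₁ _ _) (b₂ _ _)⟩,
    fun K ε => L * f (K * L) (L * ε), fun γ I hγ => ?_⟩
  obtain ⟨⟨K', ε', hK', hε', hq'⟩, hs⟩ := hf γ I hγ
  refine ⟨⟨K' * L, L * ε', by nlinarith, by positivity, hq'.1, fun i hi j hj =>
    quasi_bounds_of_bilipschitz hL hε' (hq'.2 i hi j hj) (b₁ _ _) (b₂ _ _)⟩, ?_⟩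
  intro K ε hK hε η a b hab hη ha hb i hi
  obtain ⟨j, hj, hd⟩ := hs (K * L) (L * ε) (by nlinarith) (by positivity) η a b hab
    ⟨hη.1, fun i hi j hj =>
      quasi_bounds_of_bilipschitz hL hε (hη.2 i hi j hj) (b₂ _ _) (b₁ _ _)⟩ ha hb i hi
  exact ⟨j, hj, (b₂ _ _).trans (mul_le_mul_of_nonneg_left hd (by positivity))⟩

/-- Points of a stable subgroup are joined by uniformly stable quasigeodesics inside it, so the
subgroup is a Morse set. -/
theorem _root_.IsStableEmbedding.isMorseSet {H : Subgroup G} {T : FinGenSet H}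
    (h : IsStableEmbedding T S (H.subtype : H → G)) : ∃ F, S.IsMorseSet F (H : Set G) := by
  obtain ⟨-, f, hf⟩ := h
  refine ⟨fun K ε => ⌊f K ε⌋₊, fun K ε hK hε η a b hab hη ha hb i hi => ?_⟩
  obtain ⟨q, hq, h0, h1⟩ := T.exists_isChordArc_one ⟨η a, ha⟩ ⟨η b, hb⟩ 0
  obtain ⟨x, ⟨j, -, rfl⟩, hx⟩ := (hf q _ hq.isGeodesicOn).isMorseSet K ε hK hε η a b hab hη
    ⟨0, by simp, by simp [h0]⟩ ⟨_, Set.right_mem_Icc.2 (by omega), by dsimp only; rw [h1]; rfl⟩ i hi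
  exact ⟨_, (q j).2, hx⟩

/-- Geodesics of `G` with endpoints near a stable subgroup are uniformly stable: such a geodesic
is at bounded Hausdorff distance from a geodesic of the subgroup. -/
theorem _root_.IsStableEmbedding.exists_isStableOn {H : Subgroup G} {T : FinGenSet H}
    (h : IsStableEmbedding T S (H.subtype : H → G)) (D : ℕ) :
    ∃ f : ℝ → ℝ → ℝ, ∀ (γ : ℤ → G) (a b : ℤ), a ≤ b → S.IsGeodesicOn γ (Set.Icc a b) →
      S.IsNear H D (γ a) → S.IsNear H D (γ b) → S.IsStableOn f γ (Set.Icc a b) := by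
  obtain ⟨⟨K, ε, hK, hε, hqi⟩, f, hf⟩ := h
  set F : ℝ → ℝ → ℕ := fun K ε => ⌊f K ε⌋₊ with hF
  set D' : ℕ := F 1 (0 + 2 * D) + D with hD'
  set R : ℕ := ⌊K * (K * (2 * D' + 1 + ε)) + ε⌋₊ + D' with hR
  refine ⟨fun K ε => ((F K (ε + 2 * D') + D' + R : ℕ) : ℝ), fun γ a b hab hγ ha hb => ?_⟩
  obtain ⟨x, hxH, hx⟩ := ha
  obtain ⟨y, hyH, hy⟩ := hb
  obtain ⟨q, hq, h0, h1⟩ := T.exists_isChordArc_one ⟨x, hxH⟩ ⟨y, hyH⟩ 0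
  rw [zero_add] at hq h1
  set l : ℤ := ((T.wordDist (⟨x, hxH⟩ : H) ⟨y, hyH⟩ : ℕ) : ℤ) with hl
  have hl0 : 0 ≤ l := by omega
  have hqg := hq.isGeodesicOn
  have hM := (hf q _ hqg).isMorseSet
  have hnear : ∀ i ∈ Set.Icc a b, ∃ j ∈ Set.Icc 0 l, S.wordDist (γ i) (q j) ≤ D' := by
    intro i hi
    obtain ⟨_, ⟨j, hj, rfl⟩, hd⟩ := hM.exists_wordDist_le le_rfl le_rfl hab
      hγ.isQuasiGeodesicOn (D := D)
      ⟨x, ⟨0, by simp [hl0], by simp [h0]⟩, hx⟩ ⟨y, ⟨l, by simp [hl0], by simp [h1]⟩, hy⟩ hi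
    exact ⟨j, hj, hd⟩
  -- Two points of the subgroup geodesic close to the same vertex bound a short subpath.
  have hbetween : ∀ i j j' : ℤ, j ∈ Set.Icc 0 l → j' ∈ Set.Icc 0 l →
      S.wordDist (γ i) (q j) ≤ D' → S.wordDist (γ i) (q j') ≤ D' + 1 →
      ∀ k, j ≤ k → k ≤ j' → S.wordDist (γ i) (q k) ≤ R := by
    intro i j j' hj hj' hd hd' k hjk hkj
    have e1 : (T.wordDist (q j) (q j') : ℝ) = j' - j := by
      have := hqg.2 j hj j' hj'
      rw [abs_of_nonpos (by omega)] at this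
      exact_mod_cast (by omega : (T.wordDist (q j) (q j') : ℤ) = j' - j)
    have e2 : (T.wordDist (q j) (q k) : ℝ) = k - j := by
      have := hqg.2 j hj k ⟨hj.1.trans hjk, hkj.trans hj'.2⟩
      rw [abs_of_nonpos (by omega)] at this
      exact_mod_cast (by omega : (T.wordDist (q j) (q k) : ℤ) = k - j)
    have q1 := (hqi (q j) (q j')).1
    have q2 := (hqi (q j) (q k)).2
    simp only [Subgroup.subtype_apply] at q1 q2
    have t1 : (S.wordDist (q j : G) (q j') : ℝ) ≤ 2 * D' + 1 := by
      have := S.wordDist_triangle (q j : G) (γ i) (q j')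
      rw [S.wordDist_comm (q j : G) (γ i)] at this
      exact_mod_cast (by omega : S.wordDist (q j : G) (q j') ≤ 2 * D' + 1)
    have q3 : (j' : ℝ) - j ≤ K * (2 * D' + 1 + ε) := by
      rw [e1] at q1
      have : ((j' : ℝ) - j) / K ≤ 2 * D' + 1 + ε := by linarith
      rw [div_le_iff₀ (by linarith)] at this
      linarith
    have q4 : (k : ℝ) - j ≤ K * (2 * D' + 1 + ε) := by
      have : (k : ℝ) ≤ j' := by exact_mod_cast hkj
      linarith
    have q5 : S.wordDist (q j : G) (q k) ≤ ⌊K * (K * (2 * D' + 1 + ε)) + ε⌋₊ := by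
      refine Nat.le_floor (q2.trans ?_)
      rw [e2]
      gcongr
    have := S.wordDist_triangle (γ i) (q j) (q k)
    omega
  have hcov : ∀ n : ℕ, a + n ≤ b → ∀ j ∈ Set.Icc 0 l, S.wordDist (γ (a + n)) (q j) ≤ D' →
      ∀ k, 0 ≤ k → k ≤ j → ∃ i ∈ Set.Icc a b, S.wordDist (q k) (γ i) ≤ R := by
    intro n
    induction n with
    | zero =>
      intro _ j hj hd k hk hkj
      simp only [Nat.cast_zero, add_zero] at hd
      refine ⟨a, ⟨le_rfl, hab⟩, ?_⟩
      rw [S.wordDist_comm]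
      refine hbetween a 0 j ⟨le_rfl, hl0⟩ hj ?_ (by omega) k hk hkj
      rw [h0]
      exact hx.trans (by omega)
    | succ n ih =>
      intro hn j hj hd k hk hkj
      push_cast at hn hd
      obtain ⟨j', hj', hd'⟩ := hnear (a + n) ⟨by omega, by omega⟩
      rcases le_total k j' with hkj' | hkj'
      · exact ih (by omega) j' hj' hd' k hk hkj'
      refine ⟨a + n, ⟨by omega, by omega⟩, ?_⟩
      rw [S.wordDist_comm]
      refine hbetween (a + n) j' j hj' hj hd' ?_ k hkj' hkj
      have t := S.wordDist_triangle (γ (a + n)) (γ (a + (n + 1))) (q j)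
      have e := (hγ.isChordArc (a + n) (a + (n + 1)) (by omega) (by omega) hn).1
      omega
  have hcov' : ∀ k ∈ Set.Icc 0 l, ∃ i ∈ Set.Icc a b, S.wordDist (q k) (γ i) ≤ R := by
    intro k hk
    refine hcov (b - a).toNat (by omega) l ⟨hl0, le_rfl⟩ ?_ k hk.1 hk.2
    rw [show a + ((b - a).toNat : ℤ) = b by omega, h1]
    exact hy.trans (by omega)
  refine ⟨⟨1, 0, le_rfl, le_rfl, hγ.isQuasiGeodesicOn⟩, ?_⟩
  intro K ε hK hε η s t hst hη hs ht i hi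
  have hend : ∀ x ∈ γ '' Set.Icc a b,
      ∃ z ∈ (fun i => H.subtype (q i)) '' Set.Icc 0 l, S.wordDist x z ≤ D' := by
    rintro _ ⟨i, hi, rfl⟩
    obtain ⟨j, hj, hd⟩ := hnear i hi
    exact ⟨_, ⟨j, hj, rfl⟩, hd⟩
  obtain ⟨_, ⟨k, hk, rfl⟩, hd⟩ := hM.exists_wordDist_le hK hε hst hη (hend _ hs) (hend _ ht) hi
  obtain ⟨j, hj, hd'⟩ := hcov' k hk
  refine ⟨j, hj, ?_⟩
  have := S.wordDist_triangle (η i) (q k) (γ j)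
  have hd2 : S.wordDist (η i) (q k) ≤ F K (ε + 2 * D') + D' := hd
  exact Nat.cast_le.2 (by omega : S.wordDist (η i) (γ j) ≤ F K (ε + 2 * D') + D' + R)

end FinGenSet

namespace FinGenSet

variable {G : Type*} [Group G] {S : FinGenSet G} {H : Subgroup G}

/-! ### Geodesic lines and rays near a Morse subgroup -/

/-- Near an infinite Morse subgroup there is a bi-infinite geodesic: a pointwise limit along an
ultrafilter of geodesics with endpoints in `H`, translated by `H` so that their midpoints stay in
a fixed ball. -/
theorem IsMorseSet.exists_geodesic_line [Infinite H] {F : ℝ → ℝ → ℕ}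
    (hM : S.IsMorseSet F (H : Set G)) :
    ∃ γ : ℤ → G, (∀ a b, S.IsChordArc 1 γ a b) ∧ ∀ t, S.IsNear H (F 1 0) (γ t) := by
  set D := F 1 0
  have hseg : ∀ n : ℕ, ∃ γ : ℤ → G, S.IsChordArc 1 γ (-n) n ∧
      (∀ t, -(n : ℤ) ≤ t → t ≤ n → S.IsNear H D (γ t)) ∧ S.wordDist 1 (γ 0) ≤ D := by
    intro n
    obtain ⟨h, hH, hh⟩ : ∃ h ∈ H, 2 * n ≤ S.wordDist 1 h := by
      by_contra! hcon
      have hinf : (H : Set G).Infinite := Set.infinite_coe_iff.1 ‹Infinite H›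
      exact hinf ((S.finite_setOf_wordDist_le 1 (2 * n)).subset fun h hh => (hcon h hh).le)
    obtain ⟨γ, hγ, h0, h1⟩ := S.exists_isChordArc_one 1 h 0
    rw [zero_add] at hγ h1
    have hnear : ∀ t ∈ Set.Icc (0 : ℤ) (S.wordDist 1 h), S.IsNear H D (γ t) :=
      hM 1 0 le_rfl le_rfl γ 0 _ (by omega) hγ.isGeodesicOn.isQuasiGeodesicOn
        (by rw [h0]; exact H.one_mem) (by rw [h1]; exact hH)
    obtain ⟨k, hk, hkd⟩ := hnear n ⟨by omega, by omega⟩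
    refine ⟨fun i => k⁻¹ * γ (i + n), fun i j hi hij hj => ?_, fun t ht ht' => ?_, ?_⟩
    · rw [S.wordDist_mul_left]
      have := hγ (i + n) (j + n) (by omega) (by omega) (by omega)
      omega
    · exact (hnear (t + n) ⟨by omega, by omega⟩).mul_left (H.inv_mem hk)
    · have e : S.wordDist 1 (k⁻¹ * γ (0 + n)) = S.wordDist k (γ n) := by
        rw [← S.wordDist_mul_left k, mul_one, mul_inv_cancel_left, zero_add]
      rwa [e, S.wordDist_comm]
  choose γ hγ hnear hball using hseg
  have hlarge : ∀ t : ℤ, ∀ᶠ n : ℕ in hyperfilter ℕ, -(n : ℤ) ≤ t ∧ t ≤ n := by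
    intro t
    refine Nat.hyperfilter_le_atTop ?_
    filter_upwards [eventually_ge_atTop t.natAbs] with n hn
    omega
  have hlim : ∀ t : ℤ, ∃ x : G, ∀ᶠ n : ℕ in hyperfilter ℕ, γ n t = x := by
    intro t
    have hmem : {g : G | S.wordDist 1 g ≤ D + t.natAbs} ∈
        Ultrafilter.map (fun n => γ n t) (hyperfilter ℕ) := by
      rw [Ultrafilter.mem_map]
      filter_upwards [hlarge t] with n hn
      have h1 := hball n
      have h2 := S.wordDist_triangle 1 (γ n 0) (γ n t)
      have h3 : (S.wordDist (γ n 0) (γ n t) : ℤ) ≤ t.natAbs := by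
        have := (hγ n).isGeodesicOn.2 0 ⟨by omega, by omega⟩ t hn
        rw [this, zero_sub, abs_neg, Int.natCast_natAbs]
      change S.wordDist 1 (γ n t) ≤ D + t.natAbs
      omega
    obtain ⟨x, -, hx⟩ := Ultrafilter.eq_pure_of_finite_mem (S.finite_setOf_wordDist_le 1 _) hmem
    refine ⟨x, ?_⟩
    have : ({x} : Set G) ∈ Ultrafilter.map (fun n => γ n t) (hyperfilter ℕ) := by
      rw [hx]
      exact Set.mem_singleton x
    exact this
  choose l hl using hlim
  refine ⟨l, fun a b i j hi hij hj => ?_, fun t => ?_⟩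
  · obtain ⟨n, ⟨⟨h1, h2⟩, h3⟩, h4⟩ :=
      (((hl i).and (hl j)).and (hlarge i)).and (hlarge j) |>.exists
    rw [← h1, ← h2]
    exact hγ n i j h3.1 hij h4.2
  · obtain ⟨n, h1, h2⟩ := ((hl t).and (hlarge t)).exists
    rw [← h1]
    exact hnear n t h2.1 h2.2

theorem _root_.IsStableEmbedding.exists_isStablyJoined {T : FinGenSet H}
    (h : IsStableEmbedding T S (H.subtype : H → G)) :
    ∃ f : ℝ → ℝ → ℝ, ∀ x ∈ H, S.IsStablyJoined f x := by
  obtain ⟨f, hf⟩ := h.exists_isStableOn 0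
  refine ⟨f, fun x hx => ?_⟩
  obtain ⟨γ, hγ, h0, h1⟩ := S.exists_isChordArc_one 1 x 0
  rw [zero_add] at hγ h1
  refine ⟨γ, S.wordDist 1 x, by omega, hγ.isGeodesicOn, h0, h1,
    hf γ _ _ (by omega) hγ.isGeodesicOn ?_ ?_⟩
  · rw [h0]
    exact isNear_of_mem H.one_mem
  · rw [h1]
    exact isNear_of_mem hx

theorem gromovProduct_of_isChordArc_one {γ : ℤ → G} (hγ : ∀ b, S.IsChordArc 1 γ 0 b) (i j : ℕ) :
    S.gromovProduct (γ 0) (γ i) (γ j) = min (i : ℝ) j := by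
  have key : ∀ i j : ℕ, i ≤ j → (S.wordDist (γ i) (γ j) : ℝ) = j - i := by
    intro i j hij
    have := hγ j i j (by omega) (by omega) le_rfl
    exact_mod_cast (by omega : (S.wordDist (γ i) (γ j) : ℤ) = j - i)
  have k1 := key 0 i (Nat.zero_le _)
  have k2 := key 0 j (Nat.zero_le _)
  simp only [Nat.cast_zero, sub_zero] at k1 k2
  unfold gromovProduct
  rw [k1, k2]
  rcases le_total i j with hij | hij
  · rw [key i j hij, min_eq_left (by exact_mod_cast hij)]
    ring
  · rw [S.wordDist_comm, key j i hij, min_eq_right (by exact_mod_cast hij)]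
    ring

/-- A geodesic ray near a stable subgroup is Morse and defines a point of the limit set. -/
theorem _root_.IsStableEmbedding.exists_morseRay {T : FinGenSet H}
    (h : IsStableEmbedding T S (H.subtype : H → G)) {γ : ℤ → G}
    (hγ : ∀ b, S.IsChordArc 1 γ 0 b) {D : ℕ} (hD : ∀ t, 0 ≤ t → S.IsNear H D (γ t)) :
    ∃ α : MorseRay S, α.toFun = γ ∧ MorseBoundary.mk α ∈ limitSet S H := by
  have hgeo : S.IsGeodesicOn γ (Set.Ici 0) := ⟨Set.ordConnected_Ici, fun i hi j hj =>
    (hγ (max i j)).isGeodesicOn.2 i ⟨hi, le_max_left _ _⟩ j ⟨hj, le_max_right _ _⟩⟩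
  obtain ⟨f, hf⟩ := h.exists_isStableOn D
  have hst : S.IsStableOn f γ (Set.Ici 0) := by
    refine ⟨⟨1, 0, le_rfl, le_rfl, hgeo.isQuasiGeodesicOn⟩, ?_⟩
    rintro K ε hK hε η a b hab hη ⟨p, hp, hpa⟩ ⟨q, hq, hqb⟩ i hi
    have hm : (0 : ℤ) ≤ max p q := le_max_of_le_left hp
    obtain ⟨j, hj, hd⟩ := (hf γ 0 (max p q) hm (hγ _).isGeodesicOn (hD 0 le_rfl)
      (hD _ hm)).2 K ε hK hε η a b hab hη ⟨p, ⟨hp, le_max_left _ _⟩, hpa⟩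
      ⟨q, ⟨hq, le_max_right _ _⟩, hqb⟩ i hi
    exact ⟨j, hj.1, hd⟩
  have hx : ∀ n : ℕ, S.IsNear H D (γ n) := fun n => hD n (by omega)
  choose x hxH hxd using hx
  obtain ⟨f', hf'⟩ := h.exists_isStablyJoined
  refine ⟨⟨γ, hgeo, f, hst⟩, rfl, x, hxH, ⟨f', fun n => hf' _ (hxH n)⟩, _, rfl, ?_⟩
  rw [tendsto_atTop]
  intro B
  obtain ⟨N, hN⟩ := exists_nat_ge (B + D + S.wordDist (γ 0) 1)
  refine eventually_atTop.2 ⟨(N, N), fun p hp => ?_⟩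
  have h1 := S.gromovProduct_le (γ 0) 1 (γ p.1) (x p.1) (γ p.2) (γ p.2)
  rw [gromovProduct_of_isChordArc_one hγ, S.wordDist_self] at h1
  have h2 : (N : ℝ) ≤ min (p.1 : ℝ) p.2 :=
    le_min (by exact_mod_cast hp.1) (by exact_mod_cast hp.2)
  have h3 : (S.wordDist (γ p.1) (x p.1) : ℝ) ≤ D := by exact_mod_cast hxd p.1
  push_cast at h1
  linarith

theorem _root_.IsStableEmbedding.smul_mem_limitSet {T : FinGenSet H}
    (h : IsStableEmbedding T S (H.subtype : H → G)) {g : G} (hg : g ∈ H) {ξ : MorseBoundary S}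
    (hξ : ξ ∈ limitSet S H) : g • ξ ∈ limitSet S H := by
  obtain ⟨x, hx, -, α, rfl, ht⟩ := hξ
  obtain ⟨f, hf⟩ := h.exists_isStablyJoined
  refine ⟨fun n => g * x n, fun n => H.mul_mem hg (hx n),
    ⟨f, fun n => hf _ (H.mul_mem hg (hx n))⟩,
    ⟨fun t => g * α.toFun t, α.isGeodesic.mul_left g, α.isStable.imp fun _ h => h.mul_left g⟩,
    rfl, ?_⟩
  refine tendsto_atTop_mono (fun p => ?_) (tendsto_atTop_add_const_right _
    (-(S.wordDist (g * 1) 1 : ℝ)) ht)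
  have h1 := S.gromovProduct_le (g * 1) 1 (g * x p.1) (g * x p.1) (g * α.toFun p.2)
    (g * α.toFun p.2)
  rw [S.gromovProduct_mul_left, S.wordDist_self, S.wordDist_self] at h1
  push_cast at h1
  linarith

/-! ### Recurrence to the subgroup -/

/-- The path `γ` returns infinitely often, as `t → ∞`, to the `C`-neighbourhood of `H`. -/
def IsRecurrent (S : FinGenSet G) (H : Subgroup G) (C : ℕ) (γ : ℤ → G) : Prop :=
  ∀ N : ℤ, ∃ t, N ≤ t ∧ S.IsNear H C (γ t)

theorem gromovProduct_le_wordDist {o x y z : G}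
    (h : S.wordDist x z + S.wordDist z y ≤ S.wordDist x y) :
    S.gromovProduct o x y ≤ S.wordDist o z := by
  have t1 := S.wordDist_triangle o z x
  have t2 := S.wordDist_triangle o z y
  rw [S.wordDist_comm z x] at t1
  have : (S.wordDist o x : ℝ) + S.wordDist o y ≤ 2 * S.wordDist o z + S.wordDist x y := by
    exact_mod_cast (by omega : S.wordDist o x + S.wordDist o y ≤
      2 * S.wordDist o z + S.wordDist x y)
  unfold gromovProduct
  linarith

/-- A Morse ray representing a limit point of `H` returns to a neighbourhood of `H`. If `x ∈ H`
and a point `y` of the ray have a large Gromov product at `1`, take the point `z` of a geodesic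
from `x` to `y` nearest to `1`. It is far from `1`, and the two paths from `1` through `z`, to
`x` and to `y`, are uniform quasigeodesics, so that `z` is close both to `H` and to the ray. -/
theorem IsMorseSet.exists_isRecurrent_of_mem_limitSet {F : ℝ → ℝ → ℕ}
    (hM : S.IsMorseSet F (H : Set G)) {β : MorseRay S}
    (hβ : MorseBoundary.mk β ∈ limitSet S H) : ∃ C, S.IsRecurrent H C β.toFun := by
  obtain ⟨x, hxH, -, α, hαβ, ht⟩ := hβ
  obtain ⟨B, hB⟩ : ∃ C : ℕ, ∀ t : ℤ, 0 ≤ t → S.wordDist (α.toFun t) (β.toFun t) ≤ C :=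
    Quotient.exact hαβ
  obtain ⟨f, hf⟩ := β.isStable
  have hMβ := hf.isMorseSet
  set Fβ : ℝ → ℝ → ℕ := fun K ε => ⌊f K ε⌋₊
  set c := S.wordDist 1 (β.toFun 0) with hc
  set K : ℝ := ((2 * 1 + 1 : ℕ) : ℝ) with hK
  have hK1 : 1 ≤ K := by norm_num [hK]
  set E : ℕ := Fβ K (0 + 2 * c) + c with hE
  refine ⟨F K 0 + E, fun N => ?_⟩
  obtain ⟨⟨i, j⟩, hij⟩ := ((tendsto_atTop.1 ht) ((N : ℝ) + c + E + B)).exists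
  simp only at hij
  set y := β.toFun j with hy
  have hgp : (N : ℝ) + c + E ≤ S.gromovProduct 1 (x i) y := by
    have h1 := S.gromovProduct_le 1 1 (x i) (x i) (α.toFun j) y
    have h2 : (S.wordDist (α.toFun j) y : ℝ) ≤ B := by exact_mod_cast hB j (by omega)
    rw [S.wordDist_self, S.wordDist_self] at h1
    push_cast at h1
    linarith
  obtain ⟨γ, hγ, h0, h1⟩ := S.exists_isChordArc_one (x i) y 0
  rw [zero_add] at hγ h1
  set n : ℤ := ((S.wordDist (x i) y : ℕ) : ℤ) with hn
  obtain ⟨m, hm, hmin⟩ := Set.exists_min_image (Set.Icc 0 n) (fun k => S.wordDist 1 (γ k))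
    (Set.finite_Icc _ _) ⟨0, by simp [hn]⟩
  have hfar : (N : ℝ) + c + E ≤ S.wordDist 1 (γ m) := by
    refine hgp.trans (gromovProduct_le_wordDist ?_)
    have a1 := (hγ 0 m le_rfl hm.1 hm.2).1
    have a2 := (hγ m n hm.1 hm.2 le_rfl).1
    rw [h0] at a1
    rw [h1] at a2
    omega
  have hfar' : N + c + E ≤ S.wordDist 1 (γ m) := by exact_mod_cast hfar
  -- The detour from `1` through the nearest point to the ray.
  obtain ⟨t, ht0, htd⟩ : ∃ t, 0 ≤ t ∧ S.wordDist (γ m) (β.toFun t) ≤ E := by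
    obtain ⟨η, hη, e0, e1⟩ := (hγ.mono hm.1 le_rfl).exists_attach le_rfl 1
      fun k hk hk' => hmin k ⟨hm.1.trans hk, hk'⟩
    have := hm.2
    obtain ⟨_, ⟨t, ht, rfl⟩, hd⟩ := hMβ.exists_wordDist_le hK1 le_rfl (by omega)
      (hη.isQuasiGeodesicOn (by norm_num)) (D := c)
      ⟨_, ⟨0, Set.mem_Ici.2 le_rfl, rfl⟩, by rw [e0]⟩
      ⟨y, ⟨j, Set.mem_Ici.2 (by omega), rfl⟩, by
        rw [e1 n hm.2, h1, S.wordDist_self]; omega⟩ (i := m) ⟨by omega, hm.2⟩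
    rw [e1 m le_rfl] at hd
    exact ⟨t, ht, hd⟩
  -- The detour from `1` through the nearest point to `x i`.
  have hz : S.IsNear H (F K 0) (γ m) := by
    have hrev := (hγ.mono le_rfl hm.2).reverse
    have hnn : γ (- -m) = γ m := by rw [neg_neg]
    obtain ⟨η, hη, e0, e1⟩ := hrev.exists_attach le_rfl 1
      (fun k hk hk' => by
        rw [hnn]
        exact hmin (-k) ⟨by omega, by have := hm.2; omega⟩)
    have := hm.1
    obtain ⟨z, hz, hd⟩ := hM K 0 hK1 le_rfl η _ _ (by omega)
      (hη.isQuasiGeodesicOn (by norm_num)) (by rw [e0]; exact H.one_mem)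
      (by rw [e1 _ (by omega), neg_zero, neg_zero, h0]; exact hxH i) (-m)
      ⟨by omega, by omega⟩
    rw [e1 _ le_rfl, neg_neg] at hd
    exact ⟨z, hz, hd⟩
  refine ⟨t, ?_, hz.trans_le (by rw [S.wordDist_comm]; omega)⟩
  have g1 := S.wordDist_triangle 1 (β.toFun 0) (β.toFun t)
  have g2 := S.wordDist_triangle 1 (β.toFun t) (γ m)
  rw [S.wordDist_comm (β.toFun t) (γ m)] at g2
  have g3 := β.isGeodesic.2 0 (Set.mem_Ici.2 le_rfl) t ht0
  rw [abs_of_nonpos (by omega)] at g3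
  omega

/-- A geodesic line returning to some neighbourhood of a Morse subgroup returns to a uniform one.
Let `d` be the inferior limit of the distances from the line to `H`. A long segment of the line
between two times realising `d`, with shortest paths to `H` attached at both ends, is a chord-arc
path with endpoints in `H` whose constant is independent of `d`. -/
theorem IsMorseSet.isRecurrent {F : ℝ → ℝ → ℕ} (hM : S.IsMorseSet F (H : Set G)) {γ : ℤ → G}
    (hγ : ∀ a b, S.IsChordArc 1 γ a b) {C : ℕ} (hC : S.IsRecurrent H C γ) :
    S.IsRecurrent H (F 7 0) γ := by
  classical
  have hex : ∃ d, S.IsRecurrent H d γ := ⟨C, hC⟩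
  set d := Nat.find hex with hd
  have hrec : S.IsRecurrent H d γ := Nat.find_spec hex
  obtain ⟨N₀, hN₀⟩ : ∃ N₀, ∀ t, N₀ ≤ t → ∀ h ∈ H, d ≤ S.wordDist h (γ t) := by
    rcases Nat.eq_zero_or_pos d with h0 | h0
    · exact ⟨0, fun t _ h _ => by omega⟩
    have := Nat.find_min hex (m := d - 1) (by omega)
    unfold IsRecurrent at this
    push Not at this
    obtain ⟨N₀, hN₀⟩ := this
    refine ⟨N₀, fun t ht h hh => ?_⟩
    by_contra hlt
    exact hN₀ t ht ⟨h, hh, by rw [S.wordDist_comm]; omega⟩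
  intro N
  obtain ⟨t₁, ht₁, h₁, hH₁, hd₁⟩ := hrec (max N N₀)
  obtain ⟨t₂, ht₂, h₂, hH₂, hd₂⟩ := hrec (t₁ + 3 * d)
  have hN₁ : N₀ ≤ t₁ := (le_max_right _ _).trans ht₁
  rw [S.wordDist_comm] at hd₁ hd₂
  have e₁ : S.wordDist h₁ (γ t₁) = d := le_antisymm hd₁ (hN₀ _ hN₁ _ hH₁)
  have e₂ : S.wordDist h₂ (γ t₂) = d := le_antisymm hd₂ (hN₀ _ (by omega) _ hH₂)
  obtain ⟨η, hη, a0, a1⟩ := (hγ t₁ t₂).exists_attach le_rfl h₁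
    fun j hj _ => hd₁.trans (hN₀ j (by omega) _ hH₁)
  rw [e₁] at hη a0
  have hη2 : η t₂ = γ t₂ := a1 _ (by omega)
  have hη1 : η t₁ = γ t₁ := a1 _ le_rfl
  obtain ⟨ζ, hζ, b0, b1⟩ := hη.reverse.exists_attach (by norm_num) h₂ (by
    intro j hj hj'
    rw [neg_neg, hη2, e₂]
    rcases le_total t₁ (-j) with hle | hle
    · rw [a1 _ hle]
      exact hN₀ _ (by omega) _ hH₂
    · have c1 := (hη (-j) t₁ (by omega) hle (by omega)).1
      have c2 := (hγ t₁ t₂ t₁ t₂ le_rfl (by omega) le_rfl).2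
      have c3 := S.wordDist_triangle (γ t₁) (η (-j)) (γ t₂)
      have c4 := S.wordDist_triangle (η (-j)) h₂ (γ t₂)
      rw [S.wordDist_comm (γ t₁) (η (-j))] at c3
      rw [S.wordDist_comm (η (-j)) h₂] at c4
      rw [hη1] at c1
      push_cast at c2
      omega)
  simp only [neg_neg] at hζ b0
  rw [hη2, e₂] at hζ b0
  refine ⟨t₁, (le_max_left _ _).trans ht₁, ?_⟩
  have hq := hζ.isQuasiGeodesicOn (by norm_num)
  rw [show ((2 * (2 * 1 + 1) + 1 : ℕ) : ℝ) = 7 by norm_num] at hq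
  obtain ⟨z, hz, hzd⟩ := hM 7 0 (by norm_num) le_rfl ζ _ _ (by omega) hq (by rw [b0]; exact hH₂)
    (by rw [b1 _ (by omega), neg_neg, a0]; exact hH₁) (-t₁) ⟨by omega, by omega⟩
  rw [b1 _ (by omega), neg_neg, hη1] at hzd
  exact ⟨z, hz, hzd⟩

/-- If a translate of a fixed geodesic line returns to neighbourhoods of a Morse subgroup in both
directions, then the translating element is uniformly close to the subgroup. -/
theorem IsMorseSet.isNear_of_isRecurrent {F : ℝ → ℝ → ℕ} (hM : S.IsMorseSet F (H : Set G))
    {γ : ℤ → G} (hγ : ∀ a b, S.IsChordArc 1 γ a b) :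
    ∃ R, ∀ g : G, (∃ C, S.IsRecurrent H C fun t => g * γ t) →
      (∃ C, S.IsRecurrent H C fun t => g * γ (-t)) → S.IsNear H R g := by
  set D := F 7 0 with hD
  refine ⟨S.wordDist 1 (γ 0) + (F 1 (0 + 2 * D) + D), ?_⟩
  rintro g ⟨C, hC⟩ ⟨C', hC'⟩
  have hg : ∀ a b, S.IsChordArc 1 (fun t => g * γ t) a b := fun a b i j hi hij hj => by
    rw [S.wordDist_mul_left]
    exact hγ a b i j hi hij hj
  have hg' : ∀ a b, S.IsChordArc 1 (fun t => g * γ (-t)) a b := fun a b => by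
    simpa using (hg (-b) (-a)).reverse
  obtain ⟨t₁, ht₁, hn₁⟩ := hM.isRecurrent hg hC 0
  obtain ⟨t₂, ht₂, hn₂⟩ := hM.isRecurrent hg' hC' 0
  have := hM.exists_wordDist_le le_rfl le_rfl (by omega : -t₂ ≤ t₁)
    (hg _ _).isGeodesicOn.isQuasiGeodesicOn hn₂ hn₁ (i := 0) ⟨by omega, ht₁⟩
  refine IsNear.trans_le this ?_
  have e := S.wordDist_mul_left g 1 (γ 0)
  rw [mul_one] at e
  rw [e]

/-! ### Finite index -/

/-- A subgroup has finite index in every overgroup contained in one of its neighbourhoods. -/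
theorem finiteIndex_subgroupOf_of_isNear {K : Subgroup G} {R : ℕ}
    (h : ∀ g ∈ K, S.IsNear H R g) : (H.subgroupOf K).FiniteIndex := by
  have hfin : ((fun b : G => (b : G ⧸ H)) '' {b | S.wordNorm b ≤ R}).Finite :=
    (S.finite_ball R).image _
  let φ : K ⧸ H.subgroupOf K → G ⧸ H := Quotient.map' (fun k => (k : G)) fun a b hab => by
    rw [QuotientGroup.leftRel_apply] at hab ⊢
    exact hab
  have hφ : Function.Injective φ := by
    rintro ⟨a⟩ ⟨b⟩ hab
    have hab' : (a : G)⁻¹ * b ∈ H :=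
      QuotientGroup.eq.1 (show ((a : G) : G ⧸ H) = (b : G) from hab)
    exact QuotientGroup.eq.2 (Subgroup.mem_subgroupOf.2 hab')
  have hrange : Set.range φ ⊆ (fun b : G => (b : G ⧸ H)) '' {b | S.wordNorm b ≤ R} := by
    rintro _ ⟨⟨k⟩, rfl⟩
    obtain ⟨x, hx, hd⟩ := h _ (K.inv_mem k.2)
    refine ⟨k * x, by simpa [wordDist] using hd, ?_⟩
    exact (QuotientGroup.eq (s := H)).2 (by simpa using hx)
  have : Finite (Set.range φ) := hfin.subset hrange
  have : Finite (K ⧸ H.subgroupOf K) :=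
    Finite.of_injective (Set.rangeFactorization φ) (Set.rangeFactorization_injective.2 hφ)
  exact Subgroup.finiteIndex_of_finite_quotient

/-- An element commensurating `H` moves `H` into a neighbourhood of itself. -/
theorem exists_isNear_of_mem_commensurator (S : FinGenSet G) {g : G}
    (hg : g ∈ Subgroup.Commensurable.commensurator H) : ∃ C, ∀ h ∈ H, S.IsNear H C (g * h) := by
  rw [Subgroup.Commensurable.commensurator_mem_iff] at hg
  set K : Subgroup G := ConjAct.toConjAct g • H with hK
  have : (H.subgroupOf K).FiniteIndex := ⟨hg.2⟩
  have : Finite (K ⧸ H.subgroupOf K) := Subgroup.finite_quotient_of_finiteIndex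
  obtain ⟨C, hC⟩ := (Set.finite_range fun q : K ⧸ H.subgroupOf K =>
    S.wordDist (((q.out : K) : G)⁻¹ * g) 1).bddAbove
  refine ⟨C, fun h hh => ?_⟩
  have hk : g * h * g⁻¹ ∈ K := by
    rw [hK, Subgroup.mem_smul_pointwise_iff_exists]
    exact ⟨h, hh, by simp [ConjAct.smul_def]⟩
  set k : K := ⟨g * h * g⁻¹, hk⟩ with hkdef
  set q : K ⧸ H.subgroupOf K := ((k⁻¹ : K) : K ⧸ H.subgroupOf K) with hq
  have hmem : (q.out : K)⁻¹ * k⁻¹ ∈ H.subgroupOf K :=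
    QuotientGroup.eq.1 (by rw [QuotientGroup.out_eq'])
  rw [Subgroup.mem_subgroupOf] at hmem
  refine ⟨_, H.inv_mem hmem, ?_⟩
  refine le_trans (le_of_eq ?_) (hC ⟨q, rfl⟩)
  dsimp only
  rw [← S.wordDist_mul_left (((q.out : K)⁻¹ * k⁻¹ : K) : G), mul_inv_cancel]
  congr 1
  simp [hkdef, mul_assoc]

end FinGenSet

open FinGenSet in
theorem proposition3p3 {G : Type*} [Group G] (S : FinGenSet G) (H : Subgroup G) [Infinite H]
    (hH : IsStableSubgroup H) :
    (H ≤ MulAction.stabilizer G (limitSet S H) ∧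
      (H.subgroupOf (MulAction.stabilizer G (limitSet S H))).FiniteIndex) ∧
    (H ≤ Subgroup.Commensurable.commensurator H ∧
      (H.subgroupOf (Subgroup.Commensurable.commensurator H)).FiniteIndex) := by
  obtain ⟨S₀, T, hS₀⟩ := hH
  have h := hS₀.change_target S
  obtain ⟨F, hM⟩ := h.isMorseSet
  obtain ⟨γ, hγ, hnear⟩ := hM.exists_geodesic_line
  have hγ' : ∀ a b, S.IsChordArc 1 (fun t => γ (-t)) a b := fun a b => by
    simpa using (hγ (-b) (-a)).reverse
  obtain ⟨R, hR⟩ := hM.isNear_of_isRecurrent hγ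
  refine ⟨⟨fun g hg => ?_, finiteIndex_subgroupOf_of_isNear (S := S) (R := R) fun g hg => ?_⟩,
    fun g hg => ?_, finiteIndex_subgroupOf_of_isNear (S := S) (R := R) fun g hg => ?_⟩
  · rw [MulAction.mem_stabilizer_iff]
    refine subset_antisymm ?_ fun ξ hξ => ?_
    · rintro _ ⟨ξ, hξ, rfl⟩
      exact h.smul_mem_limitSet hg hξ
    · exact ⟨g⁻¹ • ξ, h.smul_mem_limitSet (H.inv_mem hg) hξ, smul_inv_smul g ξ⟩
  · have hray : ∀ l : ℤ → G, (∀ a b, S.IsChordArc 1 l a b) → (∀ t, S.IsNear H (F 1 0) (l t)) →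
        ∃ C, S.IsRecurrent H C fun t => g * l t := by
      intro l hl hnl
      obtain ⟨α, rfl, hα⟩ := h.exists_morseRay (hl 0) fun t _ => hnl t
      have hgα : g • MorseBoundary.mk α ∈ limitSet S H := by
        rw [← MulAction.mem_stabilizer_iff.1 hg]
        exact Set.smul_mem_smul_set hα
      exact hM.exists_isRecurrent_of_mem_limitSet (β := ⟨fun t => g * α.toFun t,
        α.isGeodesic.mul_left g, α.isStable.imp fun _ h => h.mul_left g⟩) hgα
    exact hR g (hray γ hγ hnear) (hray _ hγ' fun t => hnear _)
  · rw [Subgroup.Commensurable.commensurator_mem_iff]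
    change (MulAut.conj g • H).Commensurable H
    rw [Subgroup.conj_smul_eq_self_of_mem hg]
  · obtain ⟨C, hC⟩ := S.exists_isNear_of_mem_commensurator hg
    have hall : ∀ t, S.IsNear H (F 1 0 + C) (g * γ t) := by
      intro t
      obtain ⟨x, hx, hd⟩ := hnear t
      exact (hC x hx).trans_le (by rw [S.wordDist_mul_left]; omega)
    exact hR g ⟨_, fun N => ⟨N, le_rfl, hall N⟩⟩ ⟨_, fun N => ⟨N, le_rfl, hall _⟩⟩
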